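/- Let $a\in\mathbb R$, $\eta,\nu,\beta>0$, and let $h:\mathbb R\to\mathbb R$ be bounded and measurable. Consider the problem (opt): maximize $\int_a^\infty h(x)f(x)\,dx$ over all functions $f:[a,\infty)\to\mathbb R$ that are convex and non-negative and satisfy $\int_a^\infty f(x)\,dx=\beta$, $f(a)=f(a+)=\eta$ and $f'_+(a)\ge-\nu$, where $f(a+)$ is the right limit and $f'_+(a)$ the right derivative of $f$ at $a$. Let $\mathcal{PL}_3^+[a,\infty)$ be the set of all non-negative continuous functions $f$ on $[a,\infty)$ for which there are $a=y_0\le y_1\le y_2\le y_3<\infty$ and $c_j,d_j\in\mathbb R$ with $f(x)=c_j+d_jx$ for $x\in[y_{j-1},y_j]$, $j=1,2,3$, and $f(x)=0$ for $x>y_3$. If (opt) is feasible, then exactly one of the following holds. 1. An optimal solution of (opt) exists, and there is one, $f^*$, that lies in $\mathcal{PL}_3^+[a,\infty)$. 2. (opt) has no optimal solution. Its optimal value $Z^*$ (the supremum of the objective over the feasible functions) is finite, and there is a sequence $f^{(k)}\in\mathcal{PL}_3^+[a,\infty)$, $k\ge1$, of functions feasible for (opt), with breakpoints $y_j^{(k)}$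 and coefficients $c_j^{(k)},d_j^{(k)}$ as above, such that $\int_a^\infty h(x)f^{(k)}(x)\,dx\to Z^*$ as $k\to\infty$. Moreover, the last line segment $\{c_3^{(k)}+d_3^{(k)}x:x\in[y_2^{(k)},y_3^{(k)}]\}$ of $f^{(k)}$ is nondegenerate with negative slope ($y_2^{(k)}<y_3^{(k)}$ and $d_3^{(k)}<0$, so $y_3^{(k)}$ is the right endpoint of the support of $f^{(k)}$), $y_3^{(k)}$ is strictly increasing in $k$ with $y_3^{(k)}\to\infty$, and $|d_3^{(k)}|$ is strictly decreasing in $k$ with $d_3^{(k)}\to0$. -/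

import Mathlib

open Set Filter Topology MeasureTheory

namespace TailOpt

/-- `f` is a feasible convex tail density on `[a, ∞)` for the data `η, ν, β`; the values of `f`
to the left of `a` play no role. -/
structure Feasible (a η ν β : ℝ) (f : ℝ → ℝ) : Prop where
  /-- the total mass on `[a, ∞)` is finite and equal to `β` -/
  integrable : IntegrableOn f (Ici a)
  mass : ∫ x in Ici a, f x = β
  /-- `f(a) = f(a+) = η` -/
  value : f a = η
  right_limit : Tendsto f (𝓝[>] a) (𝓝 η)
  /-- the right derivative of `f` at `a` exists and is at least `-ν` -/
  right_deriv : ∃ s : ℝ, HasDerivWithinAt f s (Ioi a) a ∧ -ν ≤ s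
  convex : ConvexOn ℝ (Ici a) f
  nonneg : ∀ x ∈ Ici a, 0 ≤ f x

/-- The objective `∫_a^∞ h(x) f(x) dx`. -/
noncomputable def objective (a : ℝ) (h f : ℝ → ℝ) : ℝ :=
  ∫ x in Ici a, h x * f x

/-- `f` is an optimal solution: feasible, and no feasible function has a larger objective. -/
def IsOptimal (a η ν β : ℝ) (h f : ℝ → ℝ) : Prop :=
  Feasible a η ν β f ∧ ∀ g, Feasible a η ν β g → objective a h g ≤ objective a h f

/-- `Z` is the optimal value: the supremum of the objective over all feasible functions. -/
def IsOptimalValue (a η ν β : ℝ) (h : ℝ → ℝ) (Z : ℝ) : Prop :=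
  IsLUB {z | ∃ g, Feasible a η ν β g ∧ objective a h g = z} Z

/-- `f` is non-negative and continuous on `[a, ∞)`, equals the affine function `c j + d j * x` on
the `j`-th interval between the consecutive breakpoints `a = y 0 ≤ y 1 ≤ ⋯ ≤ y m`, and vanishes to
the right of `y m`. (Segments are indexed from `0`.) -/
structure IsPLWith (a : ℝ) (m : ℕ) (f : ℝ → ℝ)
    (y : Fin (m + 1) → ℝ) (c d : Fin m → ℝ) : Prop where
  continuousOn : ContinuousOn f (Ici a)
  nonneg : ∀ x ∈ Ici a, 0 ≤ f x
  start : y 0 = a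
  mono : Monotone y
  affine : ∀ j : Fin m, ∀ x ∈ Icc (y j.castSucc) (y j.succ), f x = c j + d j * x
  vanish : ∀ x, y (Fin.last m) < x → f x = 0

/-- The class of non-negative continuous piecewise linear functions on `[a, ∞)` with at most `m`
line segments before vanishing. -/
def PLPlus (m : ℕ) (a : ℝ) : Set (ℝ → ℝ) :=
  {f | ∃ (y : Fin (m + 1) → ℝ) (c d : Fin m → ℝ), IsPLWith a m f y c d}

end TailOpt

/-! A feasible `f` is convex and integrable, hence decreases to `0`. Integrating `f''` twice from
infinity gives `f x = ∫ max (u - x) 0 ∂μ` for a measure `μ` on `(a, ∞)` of mass at most `ν`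
(`Feasible.exists_measure`). In terms of `μ` the problem is linear: the mass is at most `ν`, the
moments of `u - a` and of `hingeIntegral a 1`, which is `(u - a)^2 / 2`, equal `η` and `β`, and the
objective is the integral of `hingeIntegral a h`.

Fixing these three moments, a Carathéodory reduction replaces `μ` by at most three atoms without
lowering the objective (`exists_finset_moments`). Three atoms give a three-piece function, so an
optimum, if there is one, can be taken in the class.

Admissible atoms with bounded nodes form a compact set. If no optimum exists, near-optimal atoms
must therefore have arbitrarily large last node `t 2`. The bound `m 2 * (t 2 - a) ≤ η` then forces
the last slope `-m 2` to `0`, and a recursive choice makes both sequences strictly monotone. -/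

namespace TailOpt

/-! ### Integrals in convex cones and Carathéodory reduction. -/

section Cone

variable {E : Type*} [NormedAddCommGroup E] [NormedSpace ℝ E] [FiniteDimensional ℝ E]

/-- A point outside a (not necessarily closed) convex cone of a finite-dimensional space is weakly
separated from it by a nonzero linear functional. -/
theorem exists_dual_nonneg_of_notMem (C : PointedCone ℝ E) {x : E} (hx : x ∉ C) :
    ∃ l : E →L[ℝ] ℝ, l ≠ 0 ∧ (∀ y ∈ C, 0 ≤ l y) ∧ l x ≤ 0 := by
  have hconv : Convex ℝ (C : Set E) := PointedCone.convex C
  by_cases hint : (interior (C : Set E)).Nonempty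
  · obtain ⟨f, hf⟩ := geometric_hahn_banach_open_point hconv.interior isOpen_interior
      (fun h => hx (interior_subset h))
    have hle : ∀ y ∈ C, f y ≤ f x := by
      intro y hy
      have hy' : y ∈ closure (interior (C : Set E)) := by
        rw [hconv.closure_interior_eq_closure_of_nonempty_interior hint]
        exact subset_closure hy
      exact closure_minimal (fun z hz => (hf z hz).le)
        (isClosed_le f.continuous continuous_const) hy'
    refine ⟨-f, ?_, ?_, ?_⟩
    · obtain ⟨z, hz⟩ := hint
      intro h0
      have : f = 0 := by simpa using h0
      simpa [this] using hf z hz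
    · intro y hy
      by_contra! hneg
      have hpos : 0 < f y := by simpa using hneg
      have hx0 : 0 ≤ f x := by simpa using hle 0 C.zero_mem
      -- Scaling `y` inside the cone would push `f` up to `f x + 1`.
      let c : {c : ℝ // 0 ≤ c} := ⟨(f x + 1) / f y, by positivity⟩
      have h1 : f (((f x + 1) / f y) • y) ≤ f x := hle _ (Submodule.smul_mem C c hy)
      rw [map_smul, smul_eq_mul, div_mul_cancel₀ _ hpos.ne'] at h1
      linarith
    · simpa using hle 0 C.zero_mem
  -- A cone without interior spans a proper subspace. A functional vanishing there separates, after
  -- a choice of sign.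
  · rw [hconv.interior_nonempty_iff_affineSpan_eq_top] at hint
    have hspan : Submodule.span ℝ (C : Set E) < ⊤ := by
      refine lt_top_iff_ne_top.2 fun h => hint ?_
      rw [← Set.insert_eq_of_mem (show (0 : E) ∈ (C : Set E) from C.zero_mem)]
      apply SetLike.coe_injective
      rw [affineSpan_insert_zero, h]
      rfl
    obtain ⟨f, hf0, hf⟩ := Submodule.exists_le_ker_of_lt_top _ hspan
    have hfC : ∀ y ∈ C, f y = 0 := fun y hy => hf (Submodule.subset_span hy)
    have hne : LinearMap.toContinuousLinearMap f ≠ 0 := by simpa using hf0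
    rcases le_total (f x) 0 with h | h
    · exact ⟨LinearMap.toContinuousLinearMap f, hne, fun y hy => (hfC y hy).ge, h⟩
    · exact ⟨-LinearMap.toContinuousLinearMap f, by simpa using hf0, 
        fun y hy => by simp [hfC y hy], by simpa using h⟩

/-- The integral of a function with values in a convex cone of a finite-dimensional space belongs
to the cone, which need not be closed. -/
theorem integral_mem_pointedCone {Ω : Type*} [MeasurableSpace Ω] {μ : Measure Ω} (n : ℕ) :
    ∀ {E : Type*} [NormedAddCommGroup E] [NormedSpace ℝ E] [FiniteDimensional ℝ E],
      Module.finrank ℝ E = n → ∀ (C : PointedCone ℝ E) {φ : Ω → E}, Integrable φ μ →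
      (∀ᵐ ω ∂μ, φ ω ∈ C) → ∫ ω, φ ω ∂μ ∈ C := by
  induction n using Nat.strong_induction_on with
  | _ n ih =>
  intro E _ _ _ hn C φ hφ hC
  by_contra hx
  obtain ⟨l, hl0, hlC, hlx⟩ := exists_dual_nonneg_of_notMem C hx
  have hnn : 0 ≤ᵐ[μ] fun ω => l (φ ω) := hC.mono fun ω h => hlC _ h
  -- The integral is both `≥ 0` and `l x ≤ 0`, so `φ` lies a.e. in the hyperplane `ker l`, and the
  -- dimension drops. No closure of the cone is taken.
  have hzero : ∫ ω, l (φ ω) ∂μ = 0 :=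
    le_antisymm (by rwa [l.integral_comp_comm hφ]) (integral_nonneg_of_ae hnn)
  have hker : ∀ᵐ ω ∂μ, l (φ ω) = 0 :=
    (integral_eq_zero_iff_of_nonneg_ae hnn (l.integrable_comp hφ)).1 hzero
  let V : Submodule ℝ E := LinearMap.ker (l : E →ₗ[ℝ] ℝ)
  obtain ⟨P, hP⟩ := LinearMap.exists_leftInverse_of_injective V.subtype (by simp)
  have hPV : ∀ v : V, P v = v := fun v => LinearMap.congr_fun hP v
  let P' : E →L[ℝ] V := LinearMap.toContinuousLinearMap P
  have hcoe : ∀ᵐ ω ∂μ, ((P' (φ ω) : V) : E) = φ ω := hker.mono fun ω h =>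
    congrArg Subtype.val (hPV ⟨φ ω, h⟩)
  have hVlt : Module.finrank ℝ V < n := by
    rw [← hn]
    refine Submodule.finrank_lt (fun h => hl0 ?_)
    ext v
    have : v ∈ V := h ▸ Submodule.mem_top
    exact this
  have hmem := ih _ hVlt (E := V) rfl (C.comap V.subtype) (P'.integrable_comp hφ) (by
    filter_upwards [hcoe, hC] with ω h1 h2
    rw [PointedCone.mem_comap]
    change ((P' (φ ω) : V) : E) ∈ C
    rwa [h1])
  apply hx
  have h3 : ((∫ ω, P' (φ ω) ∂μ : V) : E) = ∫ ω, φ ω ∂μ := by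
    rw [← integral_congr_ae hcoe]
    exact (V.subtypeL.integral_comp_comm (P'.integrable_comp hφ)).symm
  rw [← h3]
  exact hmem

end Cone

/-- A positive combination of vectors of a finite-dimensional space on which some linear
functional is positive can be rewritten with at most `finrank` many terms, without decreasing a
prescribed linear objective. -/
theorem exists_card_le_finrank {ι E : Type*} [AddCommGroup E] [Module ℝ E] [FiniteDimensional ℝ E]
    (φ : ι → E) (l : E →ₗ[ℝ] ℝ) (H : ι → ℝ) (F : Finset ι) (w : ι → ℝ)
    (hl : ∀ i ∈ F, 0 < l (φ i)) (hw : ∀ i ∈ F, 0 < w i) :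
    ∃ F' ⊆ F, ∃ w' : ι → ℝ, (∀ i ∈ F', 0 < w' i) ∧ F'.card ≤ Module.finrank ℝ E ∧
      ∑ i ∈ F', w' i • φ i = ∑ i ∈ F, w i • φ i ∧
      ∑ i ∈ F, w i * H i ≤ ∑ i ∈ F', w' i * H i := by
  classical
  induction hk : F.card using Nat.strong_induction_on generalizing F w with
  | _ k ih =>
  by_cases hcard : F.card ≤ Module.finrank ℝ E
  · exact ⟨F, subset_rfl, w, hw, hcard, rfl, le_rfl⟩
  have hdep : ¬ LinearIndepOn ℝ φ (F : Set ι) := by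
    intro h
    have := LinearIndependent.fintype_card_le_finrank h
    simp at this
    omega
  rw [linearIndepOn_finset_iff] at hdep
  push Not at hdep
  obtain ⟨v, hv0, i₀, hi₀, hvi₀⟩ := hdep
  -- Either sign of the relation `v` preserves the combination; one of them does not lower the
  -- objective.
  wlog hvH : 0 ≤ ∑ i ∈ F, v i * H i generalizing v
  · exact this (-v) (by simpa using hv0) (by simpa using hvi₀) (by
      simp only [Pi.neg_apply, neg_mul, Finset.sum_neg_distrib]; linarith)
  -- Positivity of `l` excludes a relation with only non-negative coefficients, so moving along `v`
  -- must exhaust some weight.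
  have hneg : ∃ i ∈ F, v i < 0 := by
    by_contra! hnn
    have h0 : ∑ i ∈ F, v i * l (φ i) = 0 := by
      simpa using congrArg l hv0
    have := (Finset.sum_eq_zero_iff_of_nonneg
      (fun i hi => mul_nonneg (hnn i hi) (hl i hi).le)).1 h0 i₀ hi₀
    exact (mul_ne_zero hvi₀ (hl _ hi₀).ne') this
  obtain ⟨j, hj, hjmin⟩ := Finset.exists_min_image (F.filter fun i => v i < 0)
    (fun i => w i / -v i) (by simpa [Finset.Nonempty] using hneg)
  rw [Finset.mem_filter] at hj
  -- The longest step along `v` keeping all weights non-negative; it annihilates the weight of `j`.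
  set s : ℝ := w j / -v j with hs
  have hs0 : 0 < s := div_pos (hw j hj.1) (by linarith [hj.2])
  set w₁ : ι → ℝ := fun i => w i + s * v i with hw₁
  have hw₁nn : ∀ i ∈ F, 0 ≤ w₁ i := by
    intro i hi
    rcases lt_or_ge (v i) 0 with h | h
    · have := hjmin i (Finset.mem_filter.2 ⟨hi, h⟩)
      rw [le_div_iff₀ (by linarith)] at this
      simp only [hw₁]; linarith
    · have := hw i hi
      simp only [hw₁]; positivity
  have hw₁j : w₁ j = 0 := by
    have : v j ≠ 0 := hj.2.ne
    simp only [hw₁, hs]; field_simp; ring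
  set F₁ := F.filter fun i => w₁ i ≠ 0 with hF₁
  have hlt : F₁.card < k := by
    rw [← hk]
    refine Finset.card_lt_card (Finset.filter_ssubset.2 ⟨j, hj.1, by simpa using hw₁j⟩)
  obtain ⟨F', hF', w', h1, h2, h3, h4⟩ := ih _ hlt F₁ w₁
    (fun i hi => hl i (Finset.mem_filter.1 hi).1)
    (fun i hi => lt_of_le_of_ne (hw₁nn i (Finset.mem_filter.1 hi).1)
      (Finset.mem_filter.1 hi).2.symm) rfl
  have e1 : ∑ i ∈ F₁, w₁ i • φ i = ∑ i ∈ F, w i • φ i := by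
    rw [hF₁, Finset.sum_filter_of_ne (fun i _ h => left_ne_zero_of_smul h)]
    simp only [hw₁, add_smul, mul_smul, Finset.sum_add_distrib, ← Finset.smul_sum, hv0]
    simp
  have e2 : ∑ i ∈ F₁, w₁ i * H i = ∑ i ∈ F, w i * H i + s * ∑ i ∈ F, v i * H i := by
    rw [hF₁, Finset.sum_filter_of_ne (fun i _ h => left_ne_zero_of_mul h)]
    simp only [hw₁, add_mul, mul_assoc, Finset.sum_add_distrib, ← Finset.mul_sum]
  refine ⟨F', hF'.trans (Finset.filter_subset _ _), w', h1, h2, h3.trans e1, ?_⟩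
  have := mul_nonneg hs0.le hvH
  linarith

/-! ### Feasible functions as mixtures of hinges. -/

section Representation

variable {a η ν β : ℝ} {f : ℝ → ℝ}

theorem Feasible.exists_ge_lt (hf : Feasible a η ν β f) {c y : ℝ} (hc : 0 < c) (hy : a ≤ y) :
    ∃ z, y ≤ z ∧ f z < c := by
  by_contra! hle
  have hint : IntegrableOn (fun _ : ℝ => c) (Ici y) := by
    refine (hf.integrable.mono_set (Ici_subset_Ici.2 hy)).mono' aestronglyMeasurable_const ?_
    refine (ae_restrict_iff' measurableSet_Ici).2 (Eventually.of_forall fun z hz => ?_)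
    rw [Real.norm_of_nonneg hc.le]
    exact hle z hz
  rw [integrableOn_const_iff] at hint
  simp [hc.ne'] at hint

/-- Once a convex function rises it cannot fall again, whereas integrability forces arbitrarily
small values arbitrarily far out. -/
theorem Feasible.antitoneOn (hf : Feasible a η ν β f) : AntitoneOn f (Ici a) := by
  intro x hx y hy hxy
  by_contra! hlt
  have hne : x < y := lt_of_le_of_ne hxy (fun h => by simp [h] at hlt)
  obtain ⟨z, hyz, hz⟩ := hf.exists_ge_lt (lt_of_le_of_lt (hf.nonneg x hx) hlt) hy
  have hyz' : y < z := lt_of_le_of_ne hyz (fun h => by simp [h] at hz)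
  have h1 := hf.convex.slope_mono_adjacent hx (le_trans hy hyz) hne hyz'
  have h2 : 0 < (f y - f x) / (y - x) := div_pos (by linarith) (by linarith)
  have h3 : (f z - f y) / (z - y) < 0 := div_neg_of_neg_of_pos (by linarith) (by linarith)
  linarith

theorem Feasible.tendsto_zero (hf : Feasible a η ν β f) : Tendsto f atTop (𝓝 0) := by
  rw [Metric.tendsto_atTop]
  intro ε hε
  obtain ⟨z, hz, hlt⟩ := hf.exists_ge_lt hε le_rfl
  refine ⟨z, fun x hx => ?_⟩
  have hxa : x ∈ Ici a := le_trans hz hx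
  rw [Real.dist_0_eq_abs, abs_of_nonneg (hf.nonneg x hxa)]
  exact (hf.antitoneOn hz hxa hx).trans_lt hlt

theorem Feasible.continuousOn (hf : Feasible a η ν β f) : ContinuousOn f (Ici a) := by
  intro x hx
  rcases eq_or_lt_of_le (show a ≤ x from hx) with rfl | hlt
  · rw [← continuousWithinAt_Ioi_iff_Ici, ContinuousWithinAt, hf.value]
    exact hf.right_limit
  · have := hf.convex.continuousOn_interior
    rw [interior_Ici] at this
    exact (this.continuousAt (Ioi_mem_nhds hlt)).continuousWithinAt

/-- The right derivative of `f` on `(a, ∞)`, extended to the left by the constant `-ν`. -/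
noncomputable def slopeFun (a ν : ℝ) (f : ℝ → ℝ) (t : ℝ) : ℝ :=
  open Classical in if a < t then derivWithin f (Ioi t) t else -ν

theorem Feasible.hasDerivWithinAt_slopeFun (hf : Feasible a η ν β f) {t : ℝ} (ht : a < t) :
    HasDerivWithinAt f (slopeFun a ν f t) (Ioi t) t := by
  rw [slopeFun, if_pos ht]
  exact hf.convex.hasDerivWithinAt_rightDeriv_of_mem_interior (by rwa [interior_Ici])

theorem Feasible.slope_le_slopeFun (hf : Feasible a η ν β f) {x t : ℝ} (hx : a ≤ x) (hxt : x < t) :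
    slope f x t ≤ slopeFun a ν f t := by
  have ht : a < t := hx.trans_lt hxt
  have hti : t ∈ interior (Ici a) := by rwa [interior_Ici]
  rw [slopeFun, if_pos ht]
  exact (hf.convex.slope_le_leftDeriv_of_mem_interior hx hti hxt).trans
    (hf.convex.leftDeriv_le_rightDeriv_of_mem_interior hti)

theorem Feasible.slopeFun_le_slope (hf : Feasible a η ν β f) {t y : ℝ} (ht : a < t) (hty : t < y) :
    slopeFun a ν f t ≤ slope f t y :=
  hf.convex.le_slope_of_hasDerivWithinAt_Ioi ht.le (ht.trans hty).le hty
    (hf.hasDerivWithinAt_slopeFun ht)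

theorem Feasible.neg_le_slopeFun (hf : Feasible a η ν β f) (t : ℝ) : -ν ≤ slopeFun a ν f t := by
  by_cases ht : a < t
  · obtain ⟨s, hs, hνs⟩ := hf.right_deriv
    exact hνs.trans ((hf.convex.le_slope_of_hasDerivWithinAt_Ioi self_mem_Ici ht.le ht hs).trans
      (hf.slope_le_slopeFun le_rfl ht))
  · rw [slopeFun, if_neg ht]

/-- The constant `-ν` lies below all later slopes by the constraint at `a`. Global monotonicity is
what makes a Stieltjes measure available. -/
theorem Feasible.monotone_slopeFun (hf : Feasible a η ν β f) : Monotone (slopeFun a ν f) := by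
  intro x y hxy
  by_cases hx : a < x
  · rcases eq_or_lt_of_le hxy with rfl | hlt
    · exact le_rfl
    · exact (hf.slopeFun_le_slope hx hlt).trans (hf.slope_le_slopeFun hx.le hlt)
  · rw [slopeFun, if_neg hx]
    exact hf.neg_le_slopeFun y

theorem Feasible.slopeFun_nonpos (hf : Feasible a η ν β f) {t : ℝ} (ht : a < t) :
    slopeFun a ν f t ≤ 0 := by
  refine (hf.slopeFun_le_slope ht (lt_add_one t)).trans ?_
  have := hf.antitoneOn ht.le (show t + 1 ∈ Ici a by simp only [mem_Ici]; linarith)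
    (lt_add_one t).le
  simp only [slope_def_field, add_sub_cancel_left, div_one]
  linarith

theorem Feasible.tendsto_slopeFun (hf : Feasible a η ν β f) :
    Tendsto (slopeFun a ν f) atTop (𝓝 0) := by
  have h1 : Tendsto (fun t => f t - f (t - 1)) atTop (𝓝 0) := by
    simpa [sub_eq_add_neg] using hf.tendsto_zero.sub
      (hf.tendsto_zero.comp (tendsto_atTop_add_const_right atTop (-1 : ℝ) tendsto_id))
  refine tendsto_of_tendsto_of_tendsto_of_le_of_le' h1 tendsto_const_nhds ?_ ?_
  · filter_upwards [eventually_ge_atTop (a + 1)] with t ht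
    have := hf.slope_le_slopeFun (x := t - 1) (t := t) (by linarith) (by linarith)
    simpa [slope_def_field] using this
  · filter_upwards [eventually_gt_atTop a] with t ht using hf.slopeFun_nonpos ht

theorem Feasible.integral_slopeFun (hf : Feasible a η ν β f) {x : ℝ} (hx : a ≤ x) :
    IntegrableOn (fun t => -slopeFun a ν f t) (Ioi x) ∧
      ∫ t in Ioi x, -slopeFun a ν f t = f x := by
  have hii : ∀ y, IntervalIntegrable (slopeFun a ν f) volume x y := fun y =>
    hf.monotone_slopeFun.intervalIntegrable
  have hftc : ∀ y, x ≤ y → ∫ t in x..y, -slopeFun a ν f t = f x - f y := by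
    intro y hxy
    rw [intervalIntegral.integral_neg,
      intervalIntegral.integral_eq_sub_of_hasDeriv_right_of_le hxy
        (hf.continuousOn.mono fun t ht => hx.trans ht.1)
        (fun t ht => hf.hasDerivWithinAt_slopeFun (hx.trans_lt ht.1)) (hii y)]
    ring
  have hlim : Tendsto (fun y => f x - f y) atTop (𝓝 (f x)) := by
    simpa using hf.tendsto_zero.const_sub (f x)
  have hint : IntegrableOn (fun t => -slopeFun a ν f t) (Ioi x) := by
    refine integrableOn_Ioi_of_intervalIntegral_norm_tendsto (f x) x (b := id) (l := atTop)
      (fun y => (hii y).neg.1) tendsto_id (hlim.congr' ?_)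
    filter_upwards [eventually_ge_atTop x] with y hy
    rw [← hftc y hy]
    refine intervalIntegral.integral_congr_ae (Eventually.of_forall fun t ht => ?_)
    rw [uIoc_of_le hy] at ht
    rw [Real.norm_of_nonneg]
    linarith [hf.slopeFun_nonpos (hx.trans_lt ht.1)]
  refine ⟨hint, tendsto_nhds_unique
    (intervalIntegral_tendsto_integral_Ioi x hint tendsto_id) (hlim.congr' ?_)⟩
  filter_upwards [eventually_ge_atTop x] with y hy using (hftc y hy).symm

/-- A feasible function is a mixture of the functions `x ↦ max (u - x) 0` with respect to a
measure of mass at most `ν`. -/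
theorem Feasible.exists_measure (hf : Feasible a η ν β f) (hν : 0 ≤ ν) :
    ∃ μ : Measure ℝ, IsFiniteMeasure μ ∧ (∀ᵐ u ∂μ, a < u) ∧ μ.real univ ≤ ν ∧
      ∀ x, a ≤ x → Integrable (fun u => max (u - x) 0) μ ∧ ∫ u, max (u - x) 0 ∂μ = f x := by
  set S := hf.monotone_slopeFun.stieltjesFunction with hS
  have hlim : Tendsto S atTop (𝓝 0) := by
    refine tendsto_of_tendsto_of_tendsto_of_le_of_le hf.tendsto_slopeFun
      (hf.tendsto_slopeFun.comp (tendsto_atTop_add_const_right atTop (1 : ℝ) tendsto_id)) ?_ ?_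
    · exact fun t => hf.monotone_slopeFun.le_rightLim le_rfl
    · exact fun t => hf.monotone_slopeFun.rightLim_le (lt_add_one t)
  have hIoi : ∀ t, a ≤ t → (S.measure.restrict (Ioi a)) (Ioi t) = ENNReal.ofReal (-S t) := by
    intro t ht
    rw [Measure.restrict_apply measurableSet_Ioi, inter_eq_left.2 (Ioi_subset_Ioi ht),
      S.measure_Ioi hlim, zero_sub]
  have huniv : (S.measure.restrict (Ioi a)) univ = ENNReal.ofReal (-S a) := by
    rw [Measure.restrict_apply_univ, S.measure_Ioi hlim, zero_sub]
  have hfin : IsFiniteMeasure (S.measure.restrict (Ioi a)) := ⟨by simp [huniv]⟩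
  have hae : ∀ᵐ t : ℝ, S t = slopeFun a ν f t := by
    have hc := hf.monotone_slopeFun.countable_not_continuousAt
    filter_upwards [hc.ae_notMem volume] with t (ht : ¬¬ContinuousAt _ t)
    rw [not_not] at ht
    exact ht.continuousWithinAt.rightLim_eq
  -- Tonelli: `max (u - x) 0` is the length of `{t | x < t < u}`. Slicing in `t` instead gives the
  -- integral of `μ (Ioi t) = -f' t` over `t > x`, which is `f x`.
  have hlint : ∀ x, a ≤ x → ∫⁻ u, ENNReal.ofReal (max (u - x) 0) ∂(S.measure.restrict (Ioi a)) =
      ENNReal.ofReal (f x) := by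
    intro x hx
    set μ := S.measure.restrict (Ioi a)
    have hmeas : MeasurableSet {p : ℝ × ℝ | x < p.1 ∧ p.1 < p.2} :=
      (measurableSet_lt measurable_const measurable_fst).inter
        (measurableSet_lt measurable_fst measurable_snd)
    calc ∫⁻ u, ENNReal.ofReal (max (u - x) 0) ∂μ
        = (volume.prod μ) {p : ℝ × ℝ | x < p.1 ∧ p.1 < p.2} := by
          rw [Measure.prod_apply_symm hmeas]
          refine lintegral_congr fun u => ?_
          have : (fun t => (t, u)) ⁻¹' {p : ℝ × ℝ | x < p.1 ∧ p.1 < p.2} = Ioo x u := rfl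
          rw [this, Real.volume_Ioo]
          rcases le_total (u - x) 0 with h | h <;> simp [h]
      _ = ∫⁻ t, (Ioi x).indicator (fun t => μ (Ioi t)) t := by
          rw [Measure.prod_apply hmeas]
          refine lintegral_congr fun t => ?_
          by_cases ht : x < t
          · simp [ht, Ioi, indicator]
          · simp [ht, indicator]
      _ = ∫⁻ t in Ioi x, ENNReal.ofReal (-slopeFun a ν f t) := by
          rw [lintegral_indicator measurableSet_Ioi]
          refine setLIntegral_congr_fun_ae measurableSet_Ioi ?_
          filter_upwards [hae] with t h1 h2
          rw [hIoi t (hx.trans (le_of_lt h2)), h1]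
      _ = ENNReal.ofReal (f x) := by
          rw [← (hf.integral_slopeFun hx).2,
            ofReal_integral_eq_lintegral_ofReal (hf.integral_slopeFun hx).1]
          refine (ae_restrict_iff' measurableSet_Ioi).2 (Eventually.of_forall fun t ht => ?_)
          simpa using hf.slopeFun_nonpos (hx.trans_lt ht)
  refine ⟨S.measure.restrict (Ioi a), hfin, ae_restrict_mem measurableSet_Ioi, ?_, ?_⟩
  · rw [measureReal_def, huniv, ENNReal.toReal_ofReal']
    refine max_le ?_ hν
    have h1 : slopeFun a ν f a ≤ S a := hf.monotone_slopeFun.le_rightLim le_rfl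
    have h2 : slopeFun a ν f a = -ν := by rw [slopeFun, if_neg (lt_irrefl a)]
    linarith
  · intro x hx
    have hm : AEStronglyMeasurable (fun u => max (u - x) 0) (S.measure.restrict (Ioi a)) := by
      fun_prop
    have hnn : 0 ≤ᵐ[S.measure.restrict (Ioi a)] fun u => max (u - x) 0 :=
      Eventually.of_forall fun u => le_max_right _ _
    refine ⟨⟨hm, ?_⟩, ?_⟩
    · rw [hasFiniteIntegral_iff_ofReal hnn, hlint x hx]
      exact ENNReal.ofReal_lt_top
    · rw [integral_eq_lintegral_of_nonneg_ae hnn hm, hlint x hx,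
        ENNReal.toReal_ofReal (hf.nonneg x hx)]

/-- The weighted integral of the function `x ↦ max (u - x) 0` over `[a, ∞)`. -/
noncomputable def hingeIntegral (a : ℝ) (h : ℝ → ℝ) (u : ℝ) : ℝ :=
  ∫ x in Ici a, h x * max (u - x) 0

/-- Fubini turns the objective into a linear functional of `μ`; the absolute integrand has inner
integral `|h x| * f x`, which is integrable. -/
theorem integral_hingeIntegral (hf : IntegrableOn f (Ici a)) {μ : Measure ℝ} [IsFiniteMeasure μ]
    (hμ : ∀ x, a ≤ x → Integrable (fun u => max (u - x) 0) μ ∧ ∫ u, max (u - x) 0 ∂μ = f x)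
    {h : ℝ → ℝ} (hm : Measurable h) (hb : ∃ C : ℝ, ∀ x, |h x| ≤ C) :
    Integrable (hingeIntegral a h) μ ∧ ∫ u, hingeIntegral a h u ∂μ = objective a h f := by
  obtain ⟨C, hC⟩ := hb
  have hprod : Integrable (Function.uncurry fun x u => h x * max (u - x) 0)
      ((volume.restrict (Ici a)).prod μ) := by
    have hmm : AEStronglyMeasurable (Function.uncurry fun x u => h x * max (u - x) 0)
        ((volume.restrict (Ici a)).prod μ) := by
      have : Measurable (Function.uncurry fun x u : ℝ => h x * max (u - x) 0) := by
        unfold Function.uncurry; fun_prop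
      exact this.aestronglyMeasurable
    rw [integrable_prod_iff hmm]
    constructor
    · refine (ae_restrict_iff' measurableSet_Ici).2 (Eventually.of_forall fun x hx => ?_)
      exact (hμ x hx).1.const_mul (h x)
    · have hint : IntegrableOn (fun x => |h x| * f x) (Ici a) := by
        refine Integrable.bdd_mul (c := C) hf (by fun_prop) (Eventually.of_forall fun x => ?_)
        simpa using hC x
      refine hint.congr ((ae_restrict_iff' measurableSet_Ici).2 (Eventually.of_forall fun x hx => ?_))
      simp only [Function.uncurry, norm_mul, Real.norm_eq_abs]
      rw [integral_const_mul, ← (hμ x hx).2]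
      simp only [abs_of_nonneg (le_max_right _ (0 : ℝ))]
  refine ⟨hprod.integral_prod_right, ?_⟩
  unfold hingeIntegral objective
  rw [← integral_integral_swap hprod]
  refine setIntegral_congr_fun measurableSet_Ici fun x hx => ?_
  change ∫ u, h x * max (u - x) 0 ∂μ = h x * f x
  rw [integral_const_mul, (hμ x hx).2]

end Representation

variable {a η ν β : ℝ}

/-! ### Hinges and sums of three of them. -/

section Hinge

theorem integrableOn_hinge (a u : ℝ) : IntegrableOn (fun x => max (u - x) 0) (Ici a) := by
  have hc : Continuous fun x : ℝ => max (u - x) 0 := by fun_prop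
  refine (hc.continuousOn.integrableOn_Icc (a := a) (b := u)).of_forall_sdiff_eq_zero
    measurableSet_Ici fun x hx => ?_
  have : u < x := by
    by_contra! h
    exact hx.2 ⟨hx.1, h⟩
  exact max_eq_right (by linarith)

theorem integrableOn_mul_hinge {h : ℝ → ℝ} (hm : Measurable h) (hb : ∃ C : ℝ, ∀ x, |h x| ≤ C)
    (a u : ℝ) : IntegrableOn (fun x => h x * max (u - x) 0) (Ici a) := by
  obtain ⟨C, hC⟩ := hb
  exact Integrable.bdd_mul (c := C) (integrableOn_hinge a u) (by fun_prop)
    (Eventually.of_forall fun x => hC x)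

theorem continuous_hingeIntegral {h : ℝ → ℝ} (hm : Measurable h) (hb : ∃ C : ℝ, ∀ x, |h x| ≤ C)
    (a : ℝ) : Continuous (hingeIntegral a h) := by
  obtain ⟨C, hC⟩ := hb
  rw [continuous_iff_continuousAt]
  intro u
  refine continuousAt_of_dominated (bound := fun x => C * max (u + 1 - x) 0)
    (Eventually.of_forall fun v => by fun_prop) ?_ ((integrableOn_hinge a (u + 1)).const_mul C)
    (Eventually.of_forall fun x => by fun_prop)
  filter_upwards [Iio_mem_nhds (lt_add_one u)] with v (hv : v < u + 1)
  refine Eventually.of_forall fun x => ?_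
  rw [norm_mul, Real.norm_eq_abs, Real.norm_of_nonneg (le_max_right _ _)]
  exact mul_le_mul (hC x) (max_le_max (by linarith) le_rfl) (le_max_right _ _)
    ((abs_nonneg _).trans (hC x))

theorem convexOn_hinge (u : ℝ) : ConvexOn ℝ univ fun x : ℝ => max (u - x) 0 :=
  ((convexOn_const u convex_univ).sub (concaveOn_id convex_univ)).sup
    (convexOn_const 0 convex_univ)

theorem hasDerivWithinAt_hinge {a u : ℝ} (hu : a ≤ u) :
    HasDerivWithinAt (fun x => max (u - x) 0) (if a < u then -1 else 0) (Ioi a) a := by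
  split_ifs with h
  · have h1 : HasDerivAt (fun x => u - x) (-1) a := by
      simpa using (hasDerivAt_id a).const_sub u
    refine (h1.congr_of_eventuallyEq ?_).hasDerivWithinAt
    filter_upwards [Iio_mem_nhds h] with x (hx : x < u)
    exact max_eq_left (by linarith)
  · have hau : u = a := le_antisymm (not_lt.1 h) hu
    refine (hasDerivWithinAt_const a (Ioi a) (0 : ℝ)).congr (fun x (hx : a < x) => ?_) (by simp [hau])
    exact max_eq_right (by linarith)

end Hinge

/-- The combination of the functions `x ↦ max (t i - x) 0` with weights `m i`. -/
noncomputable def hingeSum (t m : Fin 3 → ℝ) (x : ℝ) : ℝ :=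
  ∑ i, m i * max (t i - x) 0

/-- Nodes `t` and weights `m` for which `hingeSum t m` is feasible. -/
structure IsAdmissible (a η ν β : ℝ) (t m : Fin 3 → ℝ) : Prop where
  mono : Monotone t
  le : ∀ i, a ≤ t i
  nonneg : ∀ i, 0 ≤ m i
  sum_le : ∑ i, m i ≤ ν
  value : ∑ i, m i * (t i - a) = η
  mass : ∑ i, m i * hingeIntegral a (fun _ => 1) (t i) = β

theorem continuous_hingeSum (t m : Fin 3 → ℝ) : Continuous (hingeSum t m) := by
  unfold hingeSum
  fun_prop

theorem objective_hingeSum {h : ℝ → ℝ} (hm : Measurable h) (hb : ∃ C : ℝ, ∀ x, |h x| ≤ C)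
    (a : ℝ) (t m : Fin 3 → ℝ) :
    objective a h (hingeSum t m) = ∑ i, m i * hingeIntegral a h (t i) := by
  unfold objective hingeSum hingeIntegral
  simp_rw [← integral_const_mul, Finset.mul_sum]
  rw [integral_finsetSum _ fun i _ => ?_]
  · refine Finset.sum_congr rfl fun i _ => integral_congr_ae (Eventually.of_forall fun x => ?_)
    simp only
    ring
  · refine ((integrableOn_mul_hinge hm hb a (t i)).const_mul (m i)).congr
      (Eventually.of_forall fun x => ?_)
    simp only
    ring

theorem IsAdmissible.feasible {t m : Fin 3 → ℝ} (h : IsAdmissible a η ν β t m) :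
    Feasible a η ν β (hingeSum t m) where
  integrable := integrable_finsetSum _ fun i _ => (integrableOn_hinge a (t i)).const_mul (m i)
  mass := by
    have := objective_hingeSum (h := fun _ => 1) measurable_const ⟨1, by simp⟩ a t m
    rw [h.mass] at this
    simpa [objective] using this
  value := by
    rw [← h.value]
    exact Finset.sum_congr rfl fun i _ => by rw [max_eq_left (by linarith [h.le i])]
  right_limit := by
    have hv : hingeSum t m a = η := by
      rw [← h.value]
      exact Finset.sum_congr rfl fun i _ => by rw [max_eq_left (by linarith [h.le i])]
    rw [← hv]
    exact (continuous_hingeSum t m).continuousWithinAt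
  right_deriv := by
    refine ⟨∑ i, m i * (if a < t i then -1 else 0), HasDerivWithinAt.fun_sum fun i _ =>
      (hasDerivWithinAt_hinge (h.le i)).const_mul (m i), ?_⟩
    -- A node equal to `a` contributes slope `0` instead of `-1`, hence only an inequality.
    calc -ν ≤ ∑ i, m i * (-1) := by
          rw [← Finset.sum_mul]; linarith [h.sum_le]
      _ ≤ _ := Finset.sum_le_sum fun i _ => mul_le_mul_of_nonneg_left
          (by split_ifs <;> norm_num) (h.nonneg i)
  convex := by
    have hi : ∀ i, ConvexOn ℝ (Ici a) fun x => m i * max (t i - x) 0 := fun i =>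
      ((convexOn_hinge (t i)).subset (subset_univ _) (convex_Ici a)).smul (h.nonneg i)
    unfold hingeSum
    simp only [Fin.sum_univ_three]
    exact ((hi 0).add (hi 1)).add (hi 2)
  nonneg x _ := Finset.sum_nonneg fun i _ => mul_nonneg (h.nonneg i) (le_max_right _ _)

/-- On segment `j` exactly the hinges with index at least `j` contribute, so the last slope is `-m
2`. -/
theorem IsAdmissible.isPLWith {t m : Fin 3 → ℝ} (h : IsAdmissible a η ν β t m) :
    IsPLWith a 3 (hingeSum t m) (Fin.cons a t)
      (fun j => ∑ i, if j ≤ i then m i * t i else 0) (fun j => -∑ i, if j ≤ i then m i else 0) := by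
  have hmono : Monotone (Fin.cons a t : Fin 4 → ℝ) := by
    rw [Fin.monotone_iff_le_succ]
    intro i
    induction i using Fin.cases with
    | zero => simpa using h.le 0
    | succ i =>
      rw [← Fin.succ_castSucc]
      simpa using h.mono (Fin.castSucc_lt_succ (i := i)).le
  refine ⟨(continuous_hingeSum t m).continuousOn, h.feasible.nonneg, rfl, hmono, ?_, ?_⟩
  · intro j x hx
    rw [neg_mul, Finset.sum_mul, ← sub_eq_add_neg, ← Finset.sum_sub_distrib]
    refine Finset.sum_congr rfl fun i _ => ?_
    split_ifs with hji
    · have h1 : x ≤ t j := by simpa using hx.2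
      rw [max_eq_left (by linarith [h.mono hji])]
      ring
    · have h1 : (Fin.cons a t : Fin 4 → ℝ) i.succ ≤ (Fin.cons a t : Fin 4 → ℝ) j.castSucc :=
        hmono (by rw [Fin.le_def]; simp; omega)
      rw [Fin.cons_succ] at h1
      rw [max_eq_right (by linarith [hx.1])]
      ring
  · intro x hx
    have h1 : t 2 < x := hx
    refine Finset.sum_eq_zero fun i _ => ?_
    rw [max_eq_right (by linarith [h.mono (Fin.le_last i), show t (Fin.last 2) = t 2 from rfl]),
      mul_zero]

/-! ### Reduction to three nodes. -/

/-- A positive combination of at most three point evaluations, written with three ordered nodes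
of which the last one is simple and carries a positive weight. -/
theorem exists_ordered_nodes (F : Finset ℝ) (hne : F.Nonempty) (hcard : F.card ≤ 3)
    (hF : ∀ u ∈ F, a < u) (w : ℝ → ℝ) (hw : ∀ u ∈ F, 0 < w u) :
    ∃ t m : Fin 3 → ℝ, Monotone t ∧ (∀ i, a ≤ t i) ∧ (∀ i, 0 ≤ m i) ∧ t 1 < t 2 ∧ 0 < m 2 ∧
      ∀ ψ : ℝ → ℝ, ∑ i, m i * ψ (t i) = ∑ u ∈ F, w u * ψ u := by
  suffices ∃ t₀ t₁ t₂ m₀ m₁ m₂ : ℝ, a ≤ t₀ ∧ t₀ ≤ t₁ ∧ t₁ < t₂ ∧ 0 ≤ m₀ ∧ 0 ≤ m₁ ∧ 0 < m₂ ∧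
      ∀ ψ : ℝ → ℝ, m₀ * ψ t₀ + m₁ * ψ t₁ + m₂ * ψ t₂ = ∑ u ∈ F, w u * ψ u by
    obtain ⟨t₀, t₁, t₂, m₀, m₁, m₂, h0, h1, h2, h3, h4, h5, h6⟩ := this
    refine ⟨![t₀, t₁, t₂], ![m₀, m₁, m₂], ?_, ?_, ?_, h2, h5, fun ψ => ?_⟩
    · rw [Fin.monotone_iff_le_succ]
      intro i
      fin_cases i
      · exact h1
      · exact h2.le
    · intro i
      fin_cases i
      · exact h0
      · exact h0.trans h1
      · exact (h0.trans h1).trans h2.le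
    · intro i
      fin_cases i
      · exact h3
      · exact h4
      · exact h5.le
    · rw [Fin.sum_univ_three]
      exact h6 ψ
  have hm2 := F.max'_mem hne
  set t₂ := F.max' hne with ht₂
  rcases (F.erase t₂).eq_empty_or_nonempty with h1 | h1
  -- Missing nodes are placed at `a` with weight `0`.
  · refine ⟨a, a, t₂, 0, 0, w t₂, le_rfl, le_rfl, hF _ hm2, le_rfl, le_rfl, hw _ hm2, fun ψ => ?_⟩
    rw [← Finset.add_sum_erase F _ hm2, h1]
    simp
  have hm1 := (F.erase t₂).max'_mem h1
  have hlt1 : (F.erase t₂).max' h1 < t₂ := F.lt_max'_of_mem_erase_max' hne hm1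
  set t₁ := (F.erase t₂).max' h1 with ht₁
  have hm1F := Finset.mem_of_mem_erase hm1
  rcases ((F.erase t₂).erase t₁).eq_empty_or_nonempty with h0 | h0
  · refine ⟨a, t₁, t₂, 0, w t₁, w t₂, le_rfl, (hF _ hm1F).le, hlt1, le_rfl, (hw _ hm1F).le,
      hw _ hm2, fun ψ => ?_⟩
    rw [← Finset.add_sum_erase F _ hm2, ← Finset.add_sum_erase (F.erase t₂) _ hm1, h0]
    simp
    ring
  obtain ⟨t₀, ht₀⟩ : ∃ t₀, (F.erase t₂).erase t₁ = {t₀} := by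
    rw [← Finset.card_eq_one]
    have := Finset.card_erase_of_mem hm2
    have := Finset.card_erase_of_mem hm1
    have := Finset.card_pos.2 h0
    omega
  have hm0 : t₀ ∈ (F.erase t₂).erase t₁ := by simp [ht₀]
  have hlt0 : t₀ < t₁ := (F.erase t₂).lt_max'_of_mem_erase_max' h1 hm0
  have hm0F := Finset.mem_of_mem_erase (Finset.mem_of_mem_erase hm0)
  refine ⟨t₀, t₁, t₂, w t₀, w t₁, w t₂, (hF _ hm0F).le, hlt0.le, hlt1, (hw _ hm0F).le,
    (hw _ hm1F).le, hw _ hm2, fun ψ => ?_⟩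
  rw [← Finset.add_sum_erase F _ hm2, ← Finset.add_sum_erase (F.erase t₂) _ hm1, ht₀,
    Finset.sum_singleton]
  ring

/-- Finitely many moments of a measure, including any prescribed one as an inequality, are
matched by a positive combination of at most as many point evaluations as there are equations. -/
theorem exists_finset_moments {d : ℕ} {μ : Measure ℝ} {s : Set ℝ} (hs : ∀ᵐ u ∂μ, u ∈ s)
    (φ : ℝ → Fin d → ℝ) (hφ : ∀ i, Integrable (fun u => φ u i) μ)
    (l : (Fin d → ℝ) →ₗ[ℝ] ℝ) (hl : ∀ u ∈ s, 0 < l (φ u)) (H : ℝ → ℝ) (hH : Integrable H μ) :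
    ∃ (F : Finset ℝ) (w : ℝ → ℝ), (∀ u ∈ F, u ∈ s) ∧ (∀ u ∈ F, 0 < w u) ∧ F.card ≤ d ∧
      (∀ i, ∑ u ∈ F, w u * φ u i = ∫ u, φ u i ∂μ) ∧ ∫ u, H u ∂μ ≤ ∑ u ∈ F, w u * H u := by
  have hint : Integrable (fun u => (φ u, H u)) μ := (Integrable.of_eval hφ).prodMk hH
  have hmem := integral_mem_pointedCone _ rfl (PointedCone.hull ℝ ((fun u => (φ u, H u)) '' s)) hint
    (hs.mono fun u hu => PointedCone.subset_hull (mem_image_of_mem _ hu))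
  rw [PointedCone.hull, Finsupp.mem_span_image_iff_linearCombination] at hmem
  obtain ⟨p, hp, hsum⟩ := hmem
  have hps : ∀ u ∈ p.support, u ∈ s := fun u hu => hp hu
  rw [Finsupp.linearCombination_apply, Finsupp.sum] at hsum
  have hpair := integral_pair (Integrable.of_eval hφ) hH
  -- Only the coordinates `φ` are preserved and `H` serves as objective, so `d` nodes suffice
  -- instead of `d + 1`.
  obtain ⟨F, hF, w, h1, h2, h3, h4⟩ := exists_card_le_finrank φ l H p.support
    (fun u => (p u : ℝ)) (fun u hu => hl u (hps u hu))
    (fun u hu => lt_of_le_of_ne (p u).2 fun h => (Finsupp.mem_support_iff.1 hu) (Subtype.ext h.symm))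
  refine ⟨F, w, fun u hu => hps u (hF hu), h1, by simpa using h2, fun i => ?_, ?_⟩
  · have e1 := congrFun h3 i
    have e2 := congrFun (congrArg Prod.fst (hsum.trans hpair)) i
    change _ = (∫ u, φ u ∂μ) i at e2
    rw [eval_integral hφ i] at e2
    rw [← e2]
    simp only [Finset.sum_apply, Pi.smul_apply, smul_eq_mul] at e1
    rw [e1, Prod.fst_sum, Finset.sum_apply]
    rfl
  · have e2 := congrArg Prod.snd (hsum.trans hpair)
    change _ = ∫ u, H u ∂μ at e2
    rw [← e2, Prod.snd_sum]
    exact h4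

/-- Every feasible function is dominated by a feasible hinge sum. -/
theorem Feasible.exists_isAdmissible {f h : ℝ → ℝ} (hf : Feasible a η ν β f) (hη : 0 < η)
    (hν : 0 ≤ ν) (hm : Measurable h) (hb : ∃ C : ℝ, ∀ x, |h x| ≤ C) :
    ∃ t m, IsAdmissible a η ν β t m ∧ t 1 < t 2 ∧ 0 < m 2 ∧
      objective a h f ≤ ∑ i, m i * hingeIntegral a h (t i) := by
  obtain ⟨μ, hfin, hμa, hμν, hμ⟩ := hf.exists_measure hν
  obtain ⟨hK, hKo⟩ := integral_hingeIntegral hf.integrable hμ hm hb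
  obtain ⟨h1, h1o⟩ := integral_hingeIntegral hf.integrable hμ (h := fun _ => 1)
    measurable_const ⟨1, by simp⟩
  have hβ : objective a (fun _ => 1) f = β := by simpa [objective] using hf.mass
  have hval : ∀ᵐ u ∂μ, max (u - a) 0 = u - a := hμa.mono fun u hu => max_eq_left (by linarith)
  have hi : Integrable (fun u => u - a) μ := (hμ a le_rfl).1.congr hval
  have hio : ∫ u, (u - a) ∂μ = η := by
    rw [← integral_congr_ae hval, (hμ a le_rfl).2, hf.value]
  -- The constant coordinate preserves the total mass, hence the bound `ν`, and also supplies the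
  -- positive functional.
  obtain ⟨F, w, hFa, hw, hcard, hmom, hobj⟩ := exists_finset_moments (s := Ioi a) hμa
    (fun u => ![1, u - a, hingeIntegral a (fun _ => 1) u])
    (by
      intro i
      fin_cases i
      · exact integrable_const (1 : ℝ)
      · exact hi
      · exact h1)
    (LinearMap.proj 0) (fun u _ => one_pos) (hingeIntegral a h) hK
  have m0 : ∑ u ∈ F, w u * 1 = μ.real univ := by simpa using hmom 0
  have m1 : ∑ u ∈ F, w u * (u - a) = η := (hmom 1).trans hio
  have m2 : ∑ u ∈ F, w u * hingeIntegral a (fun _ => 1) u = β := (hmom 2).trans (h1o.trans hβ)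
  have hne : F.Nonempty := by
    rw [Finset.nonempty_iff_ne_empty]
    rintro rfl
    simp at m1
    exact hη.ne m1
  obtain ⟨t, m, ht, hta, hm0, hlt, hpos, hsum⟩ := exists_ordered_nodes F hne hcard hFa w hw
  refine ⟨t, m, ⟨ht, hta, hm0, ?_, ?_, ?_⟩, hlt, hpos, ?_⟩
  · have := hsum fun _ => 1
    simp only [m0] at this
    simp only [mul_one] at this
    rw [this]; exact hμν
  · exact (hsum fun u => u - a).trans m1
  · exact (hsum _).trans m2
  · rw [hsum, ← hKo]
    exact hobj

/-! ### Compactness and escape of the last node. -/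

section Optimum

theorem Feasible.objective_le {g h : ℝ → ℝ} (hg : Feasible a η ν β g) (hm : Measurable h) {C : ℝ}
    (hC : ∀ x, |h x| ≤ C) : objective a h g ≤ C * β := by
  rw [← hg.mass, ← integral_const_mul]
  refine setIntegral_mono_on
    (Integrable.bdd_mul (c := C) hg.integrable (by fun_prop) (Eventually.of_forall fun x => hC x))
    (hg.integrable.const_mul C) measurableSet_Ici fun x hx => ?_
  exact mul_le_mul_of_nonneg_right ((le_abs_self _).trans (hC x)) (hg.nonneg x hx)

/-- Weights lie in `[0, ν]`, so compactness can fail only through nodes escaping to infinity; the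
constraints are closed because `hingeIntegral` is continuous. -/
theorem isCompact_isAdmissible (a η ν β R : ℝ) :
    IsCompact {p : (Fin 3 → ℝ) × (Fin 3 → ℝ) | IsAdmissible a η ν β p.1 p.2 ∧ p.1 2 ≤ R} := by
  have hK : Continuous (hingeIntegral a fun _ => 1) :=
    continuous_hingeIntegral measurable_const ⟨1, by simp⟩ a
  have hsub : {p : (Fin 3 → ℝ) × (Fin 3 → ℝ) | IsAdmissible a η ν β p.1 p.2 ∧ p.1 2 ≤ R} =
      (Icc (fun _ => a) (fun _ => R) ×ˢ Icc (fun _ => 0) (fun _ => ν)) ∩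
        ({p | ∀ i j, i ≤ j → p.1 i ≤ p.1 j} ∩ {p | ∑ i, p.2 i ≤ ν} ∩
        {p | ∑ i, p.2 i * (p.1 i - a) = η} ∩
        {p | ∑ i, p.2 i * hingeIntegral a (fun _ => 1) (p.1 i) = β}) := by
    ext ⟨t, m⟩
    constructor
    · rintro ⟨h, hR⟩
      refine ⟨⟨⟨h.le, fun i => (h.mono (Fin.le_last i)).trans hR⟩, h.nonneg, fun i => ?_⟩,
        ⟨⟨fun i j hij => h.mono hij, h.sum_le⟩, h.value⟩, h.mass⟩
      exact (Finset.single_le_sum (fun j _ => h.nonneg j) (Finset.mem_univ i)).trans h.sum_le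
    · rintro ⟨⟨⟨h1, h2⟩, h3, -⟩, ⟨⟨h4, h5⟩, h6⟩, h7⟩
      exact ⟨⟨fun i j hij => h4 i j hij, h1, h3, h5, h6, h7⟩, h2 2⟩
  rw [hsub]
  refine (isCompact_Icc.prod isCompact_Icc).inter_right (((IsClosed.inter ?_ ?_).inter ?_).inter ?_)
  · simp only [ofPred_forall]
    exact isClosed_iInter fun i => isClosed_iInter fun j => isClosed_iInter fun _ =>
      isClosed_le (by fun_prop) (by fun_prop)
  · exact isClosed_le (by fun_prop) (by fun_prop)
  · exact isClosed_eq (by fun_prop) (by fun_prop)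
  · exact isClosed_eq (by fun_prop) (by fun_prop)

/-- If no optimal solution exists, admissible nodes can be found with objective arbitrarily close
to the supremum and arbitrarily large last node. -/
theorem exists_isAdmissible_lt_of_not_isOptimal (hη : 0 < η) (hν : 0 ≤ ν) {h : ℝ → ℝ}
    (hm : Measurable h) (hb : ∃ C : ℝ, ∀ x, |h x| ≤ C) {Z : ℝ}
    (hZ : IsOptimalValue a η ν β h Z) (hfeas : ∃ f, Feasible a η ν β f)
    (hopt : ¬ ∃ f, IsOptimal a η ν β h f) {ε : ℝ} (hε : 0 < ε) (R : ℝ) :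
    ∃ t m, IsAdmissible a η ν β t m ∧ t 1 < t 2 ∧ 0 < m 2 ∧
      Z - ε < ∑ i, m i * hingeIntegral a h (t i) ∧ R < t 2 := by
  by_contra! hle
  obtain ⟨f, hf⟩ := hfeas
  obtain ⟨_, ⟨g, hg, rfl⟩, hlt, -⟩ := hZ.exists_between (sub_lt_self Z hε)
  obtain ⟨t₀, m₀, had₀, h1, h2, h3⟩ := hg.exists_isAdmissible hη hν hm hb
  have hK := continuous_hingeIntegral hm hb a
  have hR₀ := hle t₀ m₀ had₀ h1 h2 (hlt.trans_le h3)
  obtain ⟨⟨t, m⟩, ⟨had, -⟩, hmax⟩ := (isCompact_isAdmissible a η ν β R).exists_isMaxOn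
    ⟨(t₀, m₀), had₀, hR₀⟩
    (f := fun p : (Fin 3 → ℝ) × (Fin 3 → ℝ) => ∑ i, p.2 i * hingeIntegral a h (p.1 i))
    (by fun_prop)
  refine hopt ⟨hingeSum t m, had.feasible, fun g' hg' => ?_⟩
  obtain ⟨t', m', had', h1', h2', h3'⟩ := hg'.exists_isAdmissible hη hν hm hb
  rw [objective_hingeSum hm hb]
  refine h3'.trans ?_
  -- Near-optimal nodes lie in the compact set; all other values are beaten by `(t₀, m₀)`, whose
  -- value exceeds `Z - ε`.
  by_cases hV : Z - ε < ∑ i, m' i * hingeIntegral a h (t' i)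
  · exact hmax (show (t', m') ∈ _ from ⟨had', hle t' m' had' h1' h2' hV⟩)
  · have hmax₀ : ∑ i, m₀ i * hingeIntegral a h (t₀ i) ≤ ∑ i, m i * hingeIntegral a h (t i) :=
      hmax (show (t₀, m₀) ∈ _ from ⟨had₀, hR₀⟩)
    linarith

theorem IsAdmissible.last_weight_mul_le {t m : Fin 3 → ℝ} (h : IsAdmissible a η ν β t m) :
    m 2 * (t 2 - a) ≤ η := by
  rw [← h.value]
  exact Finset.single_le_sum (f := fun i => m i * (t i - a))
    (fun i _ => mul_nonneg (h.nonneg i) (by linarith [h.le i])) (Finset.mem_univ 2)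

end Optimum

end TailOpt

/-! ### The dichotomy. -/

theorem theorem1 (a η ν β : ℝ) (hη : 0 < η) (hν : 0 < ν) (hβ : 0 < β)
    (h : ℝ → ℝ) (h_meas : Measurable h) (h_bdd : ∃ C : ℝ, ∀ x, |h x| ≤ C)
    (h_feas : ∃ f, TailOpt.Feasible a η ν β f) :
    (∃ f ∈ TailOpt.PLPlus 3 a, TailOpt.IsOptimal a η ν β h f) ∨
    ((¬ ∃ f, TailOpt.IsOptimal a η ν β h f) ∧
      ∃ (Z : ℝ) (f : ℕ → ℝ → ℝ) (y : ℕ → Fin 4 → ℝ) (c d : ℕ → Fin 3 → ℝ),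
        TailOpt.IsOptimalValue a η ν β h Z ∧
        (∀ k, TailOpt.IsPLWith a 3 (f k) (y k) (c k) (d k)) ∧
        (∀ k, TailOpt.Feasible a η ν β (f k)) ∧
        Tendsto (fun k => TailOpt.objective a h (f k)) atTop (𝓝 Z) ∧
        -- the last segment is nondegenerate and strictly decreasing, so `y k 3` is the right
        -- endpoint of the support of `f k`
        (∀ k, y k 2 < y k 3 ∧ d k 2 < 0) ∧
        StrictMono (fun k => y k 3) ∧ Tendsto (fun k => y k 3) atTop atTop ∧
        -- the (negative) last slope tends to `0` with strictly decreasing absolute value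
        StrictAnti (fun k => |d k 2|) ∧ Tendsto (fun k => d k 2) atTop (𝓝 0)) := by
  by_cases hopt : ∃ f, TailOpt.IsOptimal a η ν β h f
  · left
    obtain ⟨f, hf, hmax⟩ := hopt
    obtain ⟨t, m, had, -, -, hle⟩ := hf.exists_isAdmissible hη hν.le h_meas h_bdd
    refine ⟨TailOpt.hingeSum t m, ⟨_, _, _, had.isPLWith⟩, had.feasible, fun g hg => ?_⟩
    rw [TailOpt.objective_hingeSum h_meas h_bdd]
    exact (hmax g hg).trans hle
  right
  refine ⟨hopt, ?_⟩
  obtain ⟨Z, hZ⟩ : ∃ Z, TailOpt.IsOptimalValue a η ν β h Z := by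
    obtain ⟨f, hf⟩ := h_feas
    obtain ⟨C, hC⟩ := h_bdd
    refine ⟨_, isLUB_csSup ⟨_, f, hf, rfl⟩ ⟨C * β, ?_⟩⟩
    rintro _ ⟨g, hg, rfl⟩
    exact hg.objective_le h_meas hC
  have key := fun {ε : ℝ} (hε : 0 < ε) (R : ℝ) =>
    TailOpt.exists_isAdmissible_lt_of_not_isOptimal hη hν.le h_meas h_bdd hZ h_feas hopt hε R
  let T := {p : (Fin 3 → ℝ) × (Fin 3 → ℝ) //
    TailOpt.IsAdmissible a η ν β p.1 p.2 ∧ p.1 1 < p.1 2 ∧ 0 < p.2 2}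
  have step : ∀ (k : ℕ) (q : T), ∃ p : T,
      Z - 1 / ((k : ℝ) + 1) < ∑ i, p.1.2 i * TailOpt.hingeIntegral a h (p.1.1 i) ∧
      (k : ℝ) ≤ p.1.1 2 ∧ q.1.1 2 < p.1.1 2 ∧ p.1.2 2 < q.1.2 2 ∧ p.1.2 2 < 1 / ((k : ℝ) + 1) := by
    intro k q
    have hk : 0 < 1 / ((k : ℝ) + 1) := by positivity
    set δ := min (q.1.2 2) (1 / ((k : ℝ) + 1))
    have hδ0 : 0 < δ := lt_min q.2.2.2 hk
    -- A last node beyond `a + η / δ` forces `m 2 < δ` by `last_weight_mul_le`.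
    obtain ⟨t, m, had, h1, h2, h3, h4⟩ := key hk (max (max k (q.1.1 2)) (a + η / δ))
    rw [max_lt_iff, max_lt_iff] at h4
    have hmδ : m 2 < δ := by
      by_contra! hge
      have e1 : η / δ < t 2 - a := by linarith [h4.2]
      rw [div_lt_iff₀ hδ0] at e1
      have e2 : 0 < t 2 - a := by
        have : 0 < η / δ := by positivity
        linarith [h4.2]
      nlinarith [had.last_weight_mul_le]
    exact ⟨⟨(t, m), had, h1, h2⟩, h3, h4.1.1.le, h4.1.2, hmδ.trans_le (min_le_left _ _),
      hmδ.trans_le (min_le_right _ _)⟩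
  obtain ⟨q₀⟩ : Nonempty T := by
    obtain ⟨t, m, had, h1, h2, -⟩ := key one_pos 0
    exact ⟨⟨(t, m), had, h1, h2⟩⟩
  choose next hval hge hlt hwlt hwle using step
  let p : ℕ → T := fun k => Nat.rec (next 0 q₀) (fun k q => next (k + 1) q) k
  -- The bounds in terms of `k` hold whatever the predecessor `q`; only strict monotonicity needs
  -- `hsucc`.
  have hp : ∀ k, ∃ q, p k = next k q := fun k => by
    cases k with
    | zero => exact ⟨q₀, rfl⟩
    | succ k => exact ⟨p k, rfl⟩
  have hsucc : ∀ k, p (k + 1) = next (k + 1) (p k) := fun k => rfl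
  have hd : ∀ k, (-∑ i, if (2 : Fin 3) ≤ i then (p k).1.2 i else 0) = -(p k).1.2 2 := by
    intro k
    rw [Fin.sum_univ_three]
    simp
  have hlim : Tendsto (fun k : ℕ => 1 / ((k : ℝ) + 1)) atTop (𝓝 0) :=
    tendsto_one_div_add_atTop_nhds_zero_nat
  refine ⟨Z, fun k => TailOpt.hingeSum (p k).1.1 (p k).1.2, fun k => Fin.cons a (p k).1.1, _, _, hZ,
    fun k => (p k).2.1.isPLWith, fun k => (p k).2.1.feasible, ?_, ?_, ?_, ?_, ?_, ?_⟩
  · have hZlim : Tendsto (fun k : ℕ => Z - 1 / ((k : ℝ) + 1)) atTop (𝓝 Z) := by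
      simpa using hlim.const_sub Z
    refine tendsto_of_tendsto_of_tendsto_of_le_of_le hZlim
      tendsto_const_nhds (fun k => ?_) (fun k => hZ.1 ⟨_, (p k).2.1.feasible, rfl⟩)
    simp only
    rw [TailOpt.objective_hingeSum h_meas h_bdd]
    obtain ⟨q, hq⟩ := hp k
    rw [hq]
    exact (hval k q).le
  · intro k
    refine ⟨(p k).2.2.1, ?_⟩
    rw [hd, neg_lt_zero]
    exact (p k).2.2.2
  · refine strictMono_nat_of_lt_succ fun k => ?_
    change (p k).1.1 2 < (p (k + 1)).1.1 2
    rw [hsucc]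
    exact hlt _ _
  · refine tendsto_atTop_mono (fun k => ?_) tendsto_natCast_atTop_atTop
    change (k : ℝ) ≤ (p k).1.1 2
    obtain ⟨q, hq⟩ := hp k
    rw [hq]
    exact hge k q
  · refine strictAnti_nat_of_succ_lt fun k => ?_
    rw [hd k, hd (k + 1), abs_neg, abs_neg, abs_of_pos (p k).2.2.2, abs_of_pos (p (k + 1)).2.2.2, hsucc]
    exact hwlt _ _
  · simp only [hd]
    have hw : Tendsto (fun k => (p k).1.2 2) atTop (𝓝 0) := by
      refine squeeze_zero (fun k => (p k).2.2.2.le) (fun k => ?_) hlim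
      obtain ⟨q, hq⟩ := hp k
      rw [hq]
      exact (hwle k q).le
    simpa using hw.neg
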